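/- All graphs are finite, simple and have at least one vertex. For a graph $G$ and $D \subseteq V(G)$, let $N[D]$ be the set of vertices that lie in $D$ or are adjacent to a vertex of $D$. For a graph $F$, a set $D \subseteq V(G)$ is an $F$-isolating set of $G$ if $N[D]$ intersects the vertex set of every subgraph of $G$ isomorphic to $F$; $\iota(G,F)$ denotes the smallest size of an $F$-isolating set of $G$. For an integer $d \geq 1$ let \[\iota(d,F) = \inf\{\alpha \in \mathbb{R} : \iota(G,F) \leq \alpha |V(G)| \text{ for every graph } G \text{ with minimum degree } \delta(G) \geq d\}, \qquad \alpha_d = \frac{1+\ln(d+1)}{d+1}.\] Theorem. For any integer $d \geq 1$ and any graph $F$, \[\frac{1+o(1)}{|V(F)|}\,\alpha_d \leq \iota(d,F) \leq \alpha_d,\] where $o(1)$ denotes a function of $d$ alone (not depending on $F$) that tends to $0$ as $d \to \infty$. -/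

import Mathlib

universe u

namespace Isolation

/-- The closed neighbourhood `N[D]` of a set `D` of vertices of `G`. -/
def closedNbhd {W : Type*} (G : SimpleGraph W) (D : Finset W) : Set W :=
  {v | ∃ u ∈ D, u = v ∨ G.Adj u v}

/-- `D` is an `F`-isolating set of `G`: the closed neighbourhood of `D` meets the vertex set of
every (not necessarily induced) copy of `F` contained in `G`. -/
def IsIsolating {W V : Type*} (G : SimpleGraph W) (F : SimpleGraph V) (D : Finset W) : Prop :=
  ∀ f : SimpleGraph.Copy F G, ∃ x : V, f x ∈ closedNbhd G D

/-- The `F`-isolation number `ι(G, F)`: the smallest size of an `F`-isolating set of `G`.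
The set below is non-empty whenever `F` has a vertex, see `isIsolating_univ`. -/
noncomputable def isolationNumber {W V : Type*} [Fintype W]
    (G : SimpleGraph W) (F : SimpleGraph V) : ℕ :=
  sInf {n : ℕ | ∃ D : Finset W, IsIsolating G F D ∧ D.card = n}

/-- The real numbers `α` such that `ι(G, F) ≤ α |V(G)|` for every (finite, non-null) graph `G`
with minimum degree at least `d`. -/
def ratioSet (d : ℕ) {V : Type u} (F : SimpleGraph V) : Set ℝ :=
  {α : ℝ | ∀ (W : Type u) [Fintype W] [Nonempty W] (G : SimpleGraph W) [DecidableRel G.Adj],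
    d ≤ G.minDegree → (isolationNumber G F : ℝ) ≤ α * (Fintype.card W : ℝ)}

/-- The extremal ratio `ι(d, F)`, the infimum of `ratioSet d F`.  The infimum is a genuine one, see
`ratioSet_nonempty` and `ratioSet_bddBelow`. -/
noncomputable def extremalRatio (d : ℕ) {V : Type u} (F : SimpleGraph V) : ℝ :=
  sInf (ratioSet d F)

/-- `α_d = (1 + ln (d + 1)) / (d + 1)`. -/
noncomputable def alpha (d : ℕ) : ℝ :=
  (1 + Real.log ((d : ℝ) + 1)) / ((d : ℝ) + 1)

theorem isIsolating_univ {W V : Type*} [Fintype W] [Nonempty V]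
    (G : SimpleGraph W) (F : SimpleGraph V) : IsIsolating G F Finset.univ :=
  fun f => ⟨Classical.arbitrary V, f (Classical.arbitrary V), Finset.mem_univ _, Or.inl rfl⟩

theorem ratioSet_nonempty (d : ℕ) {V : Type u} [Nonempty V] (F : SimpleGraph V) :
    (ratioSet d F).Nonempty := by
  refine ⟨1, fun W _ _ G _ _ => ?_⟩
  have h : isolationNumber G F ≤ Fintype.card W :=
    Nat.sInf_le ⟨Finset.univ, isIsolating_univ G F, Finset.card_univ⟩
  rw [one_mul]
  exact_mod_cast h

theorem ratioSet_bddBelow (d : ℕ) {V : Type u} (F : SimpleGraph V) :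
    BddBelow (ratioSet d F) := by
  classical
  refine ⟨0, fun α hα => ?_⟩
  have h := hα (ULift.{u} (Fin (d + 1))) (⊤ : SimpleGraph (ULift.{u} (Fin (d + 1)))) (by
    apply SimpleGraph.le_minDegree_of_forall_le_degree
    intro v
    simp)
  have h0 : (0 : ℝ) ≤ α * (Fintype.card (ULift.{u} (Fin (d + 1))) : ℝ) :=
    le_trans (Nat.cast_nonneg _) h
  have hc : (0 : ℝ) < (Fintype.card (ULift.{u} (Fin (d + 1))) : ℝ) :=
    Nat.cast_pos.mpr Fintype.card_pos
  exact nonneg_of_mul_nonneg_left h0 hc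

end Isolation

/-! Upper bound: a dominating set isolates every `F`, and a random set of density `ln(d+1)/(d+1)`,
completed by the vertices it leaves undominated, has expected size at most `α_d n`
(`exists_dominating_card_le`).

Lower bound: replacing each vertex of `H` by a clique on `V(F)` turns `F`-isolation into domination
of `H` and multiplies the order by `|V(F)|` (`isolationNumber_punit_le_cliqueBlowUp`). It remains to
see that `α_d` is asymptotically sharp for domination, the case `F = K₁`. There a random family of
`d`-subsets of a `d²`-set has no small transversal (`exists_family`), and its split graph has no
small dominating set (`lt_isolationNumber_splitGraph`). -/

namespace Isolation

/-! ### Upper bound: random dominating sets. -/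

section Domination

/-- The sets isolating the one-vertex graph are the dominating sets. -/
lemma isIsolating_punit_iff {W : Type*} {G : SimpleGraph W} {D : Finset W} :
    IsIsolating G (⊥ : SimpleGraph PUnit) D ↔ ∀ w, w ∈ closedNbhd G D := by
  constructor
  · intro h w
    obtain ⟨x, hx⟩ := h ⟨⟨fun _ => w, fun h => (h : False).elim⟩, fun _ _ _ => rfl⟩
    exact hx
  · intro h f
    exact ⟨PUnit.unit, h _⟩

lemma isIsolating_of_dominating {W V : Type*} [Nonempty V] {G : SimpleGraph W}
    (F : SimpleGraph V) {D : Finset W} (h : ∀ w, w ∈ closedNbhd G D) : IsIsolating G F D :=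
  fun _ => ⟨Classical.arbitrary V, h _⟩

variable {W : Type*} [Fintype W]

lemma isolationNumber_le {V : Type*} {G : SimpleGraph W} {F : SimpleGraph V} {D : Finset W}
    (h : IsIsolating G F D) : isolationNumber G F ≤ D.card :=
  Nat.sInf_le ⟨D, h, rfl⟩

lemma exists_isIsolating_card_eq {V : Type*} [Nonempty V] (G : SimpleGraph W)
    (F : SimpleGraph V) : ∃ D : Finset W, IsIsolating G F D ∧ D.card = isolationNumber G F :=
  Nat.sInf_mem (s := {n : ℕ | ∃ D : Finset W, IsIsolating G F D ∧ D.card = n})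
    ⟨_, Finset.univ, isIsolating_univ G F, rfl⟩

/-- The probability of a set in the binomial random subset of density `p`. -/
noncomputable def binomialWeight (p : ℝ) (S : Finset W) : ℝ :=
  p ^ S.card * (1 - p) ^ (Fintype.card W - S.card)

lemma binomialWeight_nonneg {p : ℝ} (hp : 0 ≤ p) (hp1 : p ≤ 1) (S : Finset W) :
    0 ≤ binomialWeight p S :=
  mul_nonneg (pow_nonneg hp _) (pow_nonneg (sub_nonneg.2 hp1) _)

lemma sum_binomialWeight (p : ℝ) : ∑ S : Finset W, binomialWeight p S = 1 := by
  have h := Finset.sum_pow_mul_eq_add_pow p (1 - p) (Finset.univ : Finset W)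
  simpa [binomialWeight] using h

lemma sum_binomialWeight_disjoint [DecidableEq W] (p : ℝ) (T : Finset W) :
    ∑ S : Finset W with Disjoint S T, binomialWeight p S = (1 - p) ^ T.card := by
  have h := Finset.sum_pow_mul_eq_add_pow p (1 - p) Tᶜ
  rw [add_sub_cancel, one_pow] at h
  have hS : (Finset.univ.filter fun S : Finset W => Disjoint S T) = Tᶜ.powerset := by
    ext S
    simp [Finset.subset_compl_iff_disjoint_right]
  refine Eq.trans ?_ ((congrArg ((1 - p) ^ T.card * ·) h).trans (mul_one _))
  rw [hS, Finset.mul_sum]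
  refine Finset.sum_congr rfl fun S hS => ?_
  have h1 := Finset.card_le_card (Finset.mem_powerset.1 hS)
  have h2 := Finset.card_add_card_compl T
  have h3 : Fintype.card W - S.card = T.card + (Tᶜ.card - S.card) := by omega
  rw [binomialWeight, h3, pow_add]
  ring

lemma sum_binomialWeight_mem [DecidableEq W] (p : ℝ) (v : W) :
    ∑ S : Finset W with v ∈ S, binomialWeight p S = p := by
  have h := Finset.sum_filter_add_sum_filter_not Finset.univ (fun S : Finset W => v ∈ S)
    (binomialWeight p)
  have h2 := sum_binomialWeight_disjoint p {v}
  simp only [Finset.disjoint_singleton_right, Finset.card_singleton, pow_one] at h2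
  rw [sum_binomialWeight, h2] at h
  linarith

lemma exists_dominating_card_le (G : SimpleGraph W) [DecidableRel G.Adj] {d : ℕ}
    (hd : d ≤ G.minDegree) {p : ℝ} (hp : 0 ≤ p) (hp1 : p ≤ 1) :
    ∃ D : Finset W, (∀ w, w ∈ closedNbhd G D) ∧
      (D.card : ℝ) ≤ (p + (1 - p) ^ (d + 1)) * Fintype.card W := by
  classical
  -- `U S` is the set of vertices not dominated by `S`.
  let U : Finset W → Finset W := fun S =>
    Finset.univ.filter fun v => Disjoint S (insert v (G.neighborFinset v))
  have hE : ∑ S : Finset W, binomialWeight p S * ((S.card : ℝ) + (U S).card) ≤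
      (p + (1 - p) ^ (d + 1)) * Fintype.card W := by
    have e1 : ∑ S : Finset W, binomialWeight p S * (S.card : ℝ) = p * Fintype.card W := by
      calc ∑ S : Finset W, binomialWeight p S * (S.card : ℝ)
          = ∑ S : Finset W, ∑ v : W, if v ∈ S then binomialWeight p S else 0 := by
            refine Finset.sum_congr rfl fun S _ => ?_
            simp [mul_comm]
        _ = ∑ v : W, p := by
            rw [Finset.sum_comm]
            refine Finset.sum_congr rfl fun v _ => ?_
            rw [← Finset.sum_filter, sum_binomialWeight_mem]
        _ = p * Fintype.card W := by simp [mul_comm]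
    have e2 : ∑ S : Finset W, binomialWeight p S * ((U S).card : ℝ) ≤
        (1 - p) ^ (d + 1) * Fintype.card W := by
      calc ∑ S : Finset W, binomialWeight p S * ((U S).card : ℝ)
          = ∑ S : Finset W, ∑ v : W,
              if Disjoint S (insert v (G.neighborFinset v)) then binomialWeight p S else 0 := by
            refine Finset.sum_congr rfl fun S _ => ?_
            rw [← Finset.sum_filter, Finset.sum_const, nsmul_eq_mul, mul_comm]
        _ ≤ ∑ v : W, (1 - p) ^ (d + 1) := by
            rw [Finset.sum_comm]
            refine Finset.sum_le_sum fun v _ => ?_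
            rw [← Finset.sum_filter, sum_binomialWeight_disjoint,
              Finset.card_insert_of_notMem (by simp), SimpleGraph.card_neighborFinset_eq_degree]
            exact pow_le_pow_of_le_one (sub_nonneg.2 hp1) (by linarith)
              (Nat.succ_le_succ (hd.trans (G.minDegree_le_degree v)))
        _ = (1 - p) ^ (d + 1) * Fintype.card W := by simp [mul_comm]
    simp only [mul_add, Finset.sum_add_distrib]
    linarith
  obtain ⟨S, hS⟩ : ∃ S : Finset W,
      (S.card : ℝ) + (U S).card ≤ (p + (1 - p) ^ (d + 1)) * Fintype.card W := by
    by_contra! h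
    have h1 : ∑ S : Finset W, binomialWeight p S * ((S.card : ℝ) + (U S).card) >
        ∑ S : Finset W, binomialWeight p S * ((p + (1 - p) ^ (d + 1)) * Fintype.card W) := by
      refine Finset.sum_lt_sum (fun S _ =>
        mul_le_mul_of_nonneg_left (h S).le (binomialWeight_nonneg hp hp1 S)) ?_
      -- Strictness needs one set of positive weight; for `p = 0` or `p = 1` most weights vanish.
      obtain ⟨S, -, hS⟩ := Finset.exists_ne_zero_of_sum_ne_zero
        (ne_of_eq_of_ne (sum_binomialWeight (W := W) p) one_ne_zero)
      exact ⟨S, Finset.mem_univ _, mul_lt_mul_of_pos_left (h S)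
        ((binomialWeight_nonneg hp hp1 S).lt_of_ne' hS)⟩
    rw [← Finset.sum_mul, sum_binomialWeight, one_mul] at h1
    linarith
  refine ⟨S ∪ U S, fun w => ?_, le_trans ?_ hS⟩
  · by_cases hw : w ∈ U S
    · exact ⟨w, Finset.mem_union_right _ hw, Or.inl rfl⟩
    · obtain ⟨x, hxS, hx⟩ : ∃ x ∈ S, x ∈ insert w (G.neighborFinset w) := by
        simpa only [U, Finset.mem_filter, Finset.mem_univ, true_and,
          Finset.not_disjoint_iff] using hw
      refine ⟨x, Finset.mem_union_left _ hxS, ?_⟩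
      simpa [SimpleGraph.adj_comm] using hx
  · exact_mod_cast Finset.card_union_le S (U S)

end Domination

lemma alpha_pos (d : ℕ) : 0 < alpha d := by
  have : 0 ≤ Real.log ((d : ℝ) + 1) := Real.log_nonneg (by linarith [d.cast_nonneg (α := ℝ)])
  unfold alpha
  positivity

lemma alpha_mem_ratioSet (d : ℕ) {V : Type u} [Nonempty V] (F : SimpleGraph V) :
    alpha d ∈ ratioSet d F := by
  intro W _ _ G _ hd
  have h1 : (0 : ℝ) < (d : ℝ) + 1 := by positivity
  have hlog : 0 ≤ Real.log ((d : ℝ) + 1) :=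
    Real.log_nonneg (by linarith [d.cast_nonneg (α := ℝ)])
  set p : ℝ := Real.log ((d : ℝ) + 1) / ((d : ℝ) + 1) with hp
  have hp0 : 0 ≤ p := by positivity
  have hp1 : p ≤ 1 := by
    rw [hp, div_le_one h1]
    linarith [Real.log_le_sub_one_of_pos h1]
  obtain ⟨D, hD, hcard⟩ := exists_dominating_card_le G hd hp0 hp1
  have hpow : (1 - p) ^ (d + 1) ≤ 1 / ((d : ℝ) + 1) := by
    calc (1 - p) ^ (d + 1) ≤ Real.exp (-p) ^ (d + 1) :=
          pow_le_pow_left₀ (sub_nonneg.2 hp1) (Real.one_sub_le_exp_neg p) _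
      _ = 1 / ((d : ℝ) + 1) := by
          rw [← Real.exp_nat_mul, one_div, ← Real.exp_log (inv_pos.2 h1), Real.log_inv]
          congr 1
          rw [hp]
          push_cast
          field_simp
  calc (isolationNumber G F : ℝ) ≤ D.card := by
        exact_mod_cast isolationNumber_le (isIsolating_of_dominating F hD)
    _ ≤ (p + (1 - p) ^ (d + 1)) * Fintype.card W := hcard
    _ ≤ alpha d * Fintype.card W := by
        refine mul_le_mul_of_nonneg_right ?_ (Nat.cast_nonneg _)
        rw [alpha, add_div, add_comm, ← hp]
        linarith

lemma extremalRatio_le_alpha (d : ℕ) {V : Type u} [Nonempty V] (F : SimpleGraph V) :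
    extremalRatio d F ≤ alpha d :=
  csInf_le (ratioSet_bddBelow d F) (alpha_mem_ratioSet d F)

/-! ### Reduction of a general `F` to domination. -/

section BlowUp

variable {W V : Type*}

/-- The graph obtained from `H` by replacing every vertex by a clique on `V`. -/
def cliqueBlowUp (H : SimpleGraph W) (V : Type*) : SimpleGraph (W × V) where
  Adj x y := x ≠ y ∧ (x.1 = y.1 ∨ H.Adj x.1 y.1)
  symm := ⟨fun _ _ h => ⟨h.1.symm, h.2.imp Eq.symm fun h => h.symm⟩⟩
  loopless := ⟨fun _ h => h.1 rfl⟩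

lemma minDegree_le_minDegree_cliqueBlowUp [Fintype W] [Fintype V] [Nonempty W] [Nonempty V]
    (H : SimpleGraph W) [DecidableRel H.Adj] [DecidableRel (cliqueBlowUp H V).Adj] :
    H.minDegree ≤ (cliqueBlowUp H V).minDegree := by
  classical
  refine SimpleGraph.le_minDegree_of_forall_le_degree _ _ fun x => ?_
  refine (H.minDegree_le_degree x.1).trans ?_
  rw [← SimpleGraph.card_neighborFinset_eq_degree, ← SimpleGraph.card_neighborFinset_eq_degree]
  refine Finset.card_le_card_of_injOn (fun w => (w, x.2)) ?_
    (fun a _ b _ h => congrArg Prod.fst h)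
  intro w hw
  have hw' : H.Adj x.1 w := by simpa using hw
  have : (cliqueBlowUp H V).Adj x (w, x.2) :=
    ⟨fun h => hw'.ne (congrArg Prod.fst h), Or.inr hw'⟩
  simpa using this

/-- The clique over each `w` contains a copy of `F`, so an isolating set has a member equal or
adjacent to a vertex over `w`. Its projection then dominates `w`. -/
lemma isolationNumber_punit_le_cliqueBlowUp [Fintype W] [Fintype V] [Nonempty V]
    (H : SimpleGraph W) (F : SimpleGraph V) :
    isolationNumber H (⊥ : SimpleGraph PUnit) ≤ isolationNumber (cliqueBlowUp H V) F := by
  classical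
  obtain ⟨D, hD, hcard⟩ := exists_isIsolating_card_eq (cliqueBlowUp H V) F
  rw [← hcard]
  refine (isolationNumber_le (D := D.image Prod.fst) ?_).trans Finset.card_image_le
  rw [isIsolating_punit_iff]
  intro w
  obtain ⟨x, u, hu, hux⟩ := hD ⟨⟨fun x => (w, x), fun h =>
    ⟨fun e => h.ne (congrArg Prod.snd e), Or.inl rfl⟩⟩, fun a b h => congrArg Prod.snd h⟩
  refine ⟨u.1, Finset.mem_image_of_mem _ hu, ?_⟩
  rcases hux with rfl | hux
  · exact Or.inl rfl
  · exact hux.2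

end BlowUp

lemma extremalRatio_punit_le (d : ℕ) {V : Type u} [Fintype V] [Nonempty V]
    (F : SimpleGraph V) :
    extremalRatio d (⊥ : SimpleGraph PUnit.{u + 1}) / Fintype.card V ≤ extremalRatio d F := by
  classical
  have hV : (0 : ℝ) < Fintype.card V := by exact_mod_cast Fintype.card_pos
  refine le_csInf (ratioSet_nonempty d F) fun α hα => ?_
  rw [div_le_iff₀ hV]
  refine csInf_le (ratioSet_bddBelow d _) ?_
  intro W _ _ H _ hd
  have h := hα (W × V) (cliqueBlowUp H V) (hd.trans (minDegree_le_minDegree_cliqueBlowUp H))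
  rw [Fintype.card_prod, Nat.cast_mul] at h
  have h2 : (isolationNumber H (⊥ : SimpleGraph PUnit.{u + 1}) : ℝ) ≤
      isolationNumber (cliqueBlowUp H V) F := by
    exact_mod_cast isolationNumber_punit_le_cliqueBlowUp H F
  nlinarith

/-! ### Set families without small transversals. -/

section Transversal

/-- If sets of size `m` are transversals of too few families to cover all of them, some family of `d`-sets has no small
transversal. -/
lemma exists_family_of_counting (A B : Type*) [Fintype A] [Fintype B] {d m : ℕ}
    (hm : m ≤ Fintype.card B)
    (h : (Fintype.card B).choose m *
        ((Fintype.card B).choose d - (Fintype.card B - m).choose d) ^ Fintype.card A <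
      (Fintype.card B).choose d ^ Fintype.card A) :
    ∃ f : A → Finset B, (∀ i, (f i).card = d) ∧
      ∀ D : Finset B, D.card ≤ m → ∃ i, Disjoint D (f i) := by
  classical
  let X : Finset (Finset B) := Finset.univ.powersetCard d
  -- The families of `d`-sets that have `D` as a transversal.
  let bad : Finset B → Finset (A → Finset B) := fun D =>
    Fintype.piFinset fun _ => X.filter fun S => ¬ Disjoint D S
  have hbad : ∀ D ∈ (Finset.univ : Finset B).powersetCard m, (bad D).card ≤
      ((Fintype.card B).choose d - (Fintype.card B - m).choose d) ^ Fintype.card A := by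
    intro D hD
    have hDm : D.card = m := (Finset.mem_powersetCard.1 hD).2
    have e1 : X.filter (fun S => Disjoint D S) = Dᶜ.powersetCard d := by
      ext S
      simp [X, Finset.mem_powersetCard, Finset.subset_compl_iff_disjoint_left, and_comm]
    have e2 := Finset.card_filter_add_card_filter_not (s := X) (fun S => Disjoint D S)
    rw [e1, Finset.card_powersetCard, Finset.card_compl, hDm] at e2
    have e3 : X.card = (Fintype.card B).choose d := by simp [X]
    rw [Fintype.card_piFinset, Finset.prod_const, Finset.card_univ]
    exact Nat.pow_le_pow_left (by omega) _
  have hlt : (((Finset.univ : Finset B).powersetCard m).biUnion bad).card <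
      (Fintype.piFinset fun _ : A => X).card := by
    refine (Finset.card_biUnion_le_card_mul _ _ _ hbad).trans_lt ?_
    rw [Fintype.card_piFinset, Finset.prod_const, Finset.card_univ]
    simpa [X] using h
  obtain ⟨f, hf, hf'⟩ := Finset.exists_mem_notMem_of_card_lt_card hlt
  have hX : ∀ i, f i ∈ X := Fintype.mem_piFinset.1 hf
  refine ⟨f, fun i => (Finset.mem_powersetCard.1 (hX i)).2, fun D hD => ?_⟩
  -- Supersets of transversals are transversals, so only size exactly `m` has to be counted.
  obtain ⟨E, hDE, hE⟩ := Finset.exists_superset_card_eq hD hm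
  by_contra! hno
  refine hf' (Finset.mem_biUnion.2 ⟨E, by simp [Finset.mem_powersetCard, hE], ?_⟩)
  exact Fintype.mem_piFinset.2 fun i => Finset.mem_filter.2
    ⟨hX i, fun hdis => hno i (hdis.mono_left hDE)⟩

/-- The ratio of the two binomials is the product over `i < d` of `(b-m-i)/(b-i)`. The inverse of
each factor is `1 + m/(b-m-i) ≤ exp(m/(b-m-d))`. -/
lemma choose_sub_ge {b m d : ℕ} (h : m + d < b) :
    (b.choose d : ℝ) * Real.exp (-(d * m / ((b : ℝ) - m - d))) ≤ ((b - m).choose d : ℝ) := by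
  have hpos : (0 : ℝ) < (b : ℝ) - m - d := by
    have : ((m + d : ℕ) : ℝ) < b := by exact_mod_cast h
    push_cast at this
    linarith
  set e : ℝ := Real.exp (-(m / ((b : ℝ) - m - d))) with he
  have hstep : ∀ i ≤ d, (b.descFactorial i : ℝ) * e ^ i ≤ ((b - m).descFactorial i : ℝ) := by
    intro i
    induction i with
    | zero => simp
    | succ i ih =>
      intro hi
      have hid : (i : ℝ) + 1 ≤ d := by exact_mod_cast hi
      rw [Nat.descFactorial_succ, Nat.descFactorial_succ, Nat.cast_mul, Nat.cast_mul,
        Nat.cast_sub (by omega), Nat.cast_sub (by omega), Nat.cast_sub (by omega)]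
      have hx : (0 : ℝ) < (b : ℝ) - m - i := by linarith
      have key : ((b : ℝ) - i) * e ≤ (b : ℝ) - m - i := by
        rw [he, Real.exp_neg, ← div_eq_mul_inv, div_le_iff₀ (Real.exp_pos _)]
        have h1 : (m : ℝ) / ((b : ℝ) - m - i) ≤ m / ((b : ℝ) - m - d) :=
          div_le_div_of_nonneg_left (Nat.cast_nonneg _) hpos (by linarith)
        have h2 := Real.add_one_le_exp ((m : ℝ) / ((b : ℝ) - m - d))
        calc (b : ℝ) - i = ((b : ℝ) - m - i) * (m / ((b : ℝ) - m - i) + 1) := by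
              field_simp
              ring
          _ ≤ _ := mul_le_mul_of_nonneg_left (by linarith) hx.le
      calc ((b : ℝ) - i) * b.descFactorial i * e ^ (i + 1)
          = (((b : ℝ) - i) * e) * (b.descFactorial i * e ^ i) := by ring
        _ ≤ _ := mul_le_mul key (ih (by omega)) (by positivity) hx.le
  have h1 := hstep d le_rfl
  rw [Nat.descFactorial_eq_factorial_mul_choose, Nat.descFactorial_eq_factorial_mul_choose,
    he, ← Real.exp_nat_mul] at h1
  push_cast at h1
  have hf : (0 : ℝ) < d.factorial := by exact_mod_cast d.factorial_pos
  rw [mul_assoc] at h1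
  have h2 := le_of_mul_le_mul_left h1 hf
  rwa [mul_neg, ← mul_div_assoc] at h2

/-- Union bound: there are at most `b^m` sets of size `m`. Each misses a random `d`-set with
probability at least `P`, the exponential in `h`, hence meets all `a` of them with probability at
most `(1-P)^a ≤ exp(-aP)`. The hypothesis says `b^m exp(-aP) < 1`. -/
lemma exists_family (A B : Type*) [Fintype A] [Fintype B] {d m : ℕ}
    (hb : m + d < Fintype.card B)
    (h : m * Real.log (Fintype.card B) <
      Fintype.card A * Real.exp (-(d * m / ((Fintype.card B : ℝ) - m - d)))) :
    ∃ f : A → Finset B, (∀ i, (f i).card = d) ∧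
      ∀ D : Finset B, D.card ≤ m → ∃ i, Disjoint D (f i) := by
  refine exists_family_of_counting A B (by omega) ?_
  have hP := choose_sub_ge hb
  have hle : (Fintype.card B - m).choose d ≤ (Fintype.card B).choose d :=
    Nat.choose_le_choose d (Nat.sub_le _ _)
  have hCpos : 0 < (Fintype.card B).choose d := Nat.choose_pos (by omega)
  set b := Fintype.card B
  set a := Fintype.card A
  set P := Real.exp (-(d * m / ((b : ℝ) - m - d)))
  have hC : (0 : ℝ) < b.choose d := by exact_mod_cast hCpos
  have hb0 : (0 : ℝ) < b := by exact_mod_cast (by omega : 0 < b)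
  have h1 : ((b.choose d : ℝ) - (b - m).choose d) ≤ b.choose d * Real.exp (-P) := by
    have := mul_le_mul_of_nonneg_left (Real.one_sub_le_exp_neg P) hC.le
    linarith
  have h0 : (0 : ℝ) ≤ (b.choose d : ℝ) - (b - m).choose d := by
    rw [sub_nonneg]
    exact_mod_cast hle
  have h2 : (b.choose m : ℝ) ≤ Real.exp (m * Real.log b) := by
    rw [Real.exp_nat_mul, Real.exp_log hb0]
    exact_mod_cast Nat.choose_le_pow b m
  have h3 : (b.choose m : ℝ) * ((b.choose d : ℝ) - (b - m).choose d) ^ a <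
      (b.choose d : ℝ) ^ a := by
    calc (b.choose m : ℝ) * ((b.choose d : ℝ) - (b - m).choose d) ^ a
        ≤ Real.exp (m * Real.log b) * (b.choose d * Real.exp (-P)) ^ a :=
          mul_le_mul h2 (pow_le_pow_left₀ h0 h1 a) (pow_nonneg h0 a) (Real.exp_pos _).le
      _ = (b.choose d : ℝ) ^ a * Real.exp (m * Real.log b - a * P) := by
          rw [mul_pow, ← Real.exp_nat_mul, sub_eq_add_neg, Real.exp_add, mul_neg]
          ring
      _ < (b.choose d : ℝ) ^ a * 1 := by
          refine mul_lt_mul_of_pos_left ?_ (pow_pos hC a)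
          rw [Real.exp_lt_one_iff]
          linarith
      _ = _ := mul_one _
  rw [← Nat.cast_sub hle] at h3
  exact_mod_cast h3

end Transversal

/-! ### Split graphs with large domination number. -/

section SplitGraph

variable {A B : Type*}

/-- The split graph of a family `f` of subsets of `B`: the set `B` is a clique, and each index
`i` is joined to the members of `f i`. -/
def splitGraph (f : A → Finset B) : SimpleGraph (A ⊕ B) where
  Adj
    | .inl _, .inl _ => False
    | .inl i, .inr j => j ∈ f i
    | .inr j, .inl i => j ∈ f i
    | .inr j, .inr k => j ≠ k
  symm := ⟨by rintro (i | j) (k | l) h <;> first | exact h | exact Ne.symm h⟩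
  loopless := ⟨by rintro (i | j) h <;> first | exact h | exact h rfl⟩

lemma le_minDegree_splitGraph [Fintype A] [Fintype B] [Nonempty B] {f : A → Finset B}
    [DecidableRel (splitGraph f).Adj] {d : ℕ} (hf : ∀ i, (f i).card = d)
    (hd : d < Fintype.card B) : d ≤ (splitGraph f).minDegree := by
  classical
  refine SimpleGraph.le_minDegree_of_forall_le_degree _ _ fun x => ?_
  rw [← SimpleGraph.card_neighborFinset_eq_degree]
  rcases x with i | j
  · rw [← hf i]
    refine Finset.card_le_card_of_injOn Sum.inr ?_ Sum.inr_injective.injOn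
    intro j hj
    have : (splitGraph f).Adj (.inl i) (.inr j) := hj
    simpa using this
  · have hc : d ≤ (Finset.univ.erase j).card := by
      rw [Finset.card_erase_of_mem (Finset.mem_univ _), Finset.card_univ]
      omega
    refine hc.trans (Finset.card_le_card_of_injOn Sum.inr ?_ Sum.inr_injective.injOn)
    intro k hk
    have : (splitGraph f).Adj (.inr j) (.inr k) := by
      have hk' : k ≠ j := by simpa using hk
      exact hk'.symm
    simpa using this

lemma lt_isolationNumber_splitGraph [Fintype A] [Fintype B] {f : A → Finset B} {m : ℕ}
    (hne : ∀ i, (f i).Nonempty) (hf : ∀ D : Finset B, D.card ≤ m → ∃ i, Disjoint D (f i)) :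
    m < isolationNumber (splitGraph f) (⊥ : SimpleGraph PUnit) := by
  classical
  obtain ⟨D, hD, hcard⟩ := exists_isIsolating_card_eq (splitGraph f) (⊥ : SimpleGraph PUnit)
  rw [isIsolating_punit_iff] at hD
  rw [← hcard]
  by_contra! hle
  choose g hg using hne
  -- Exchanging each index `k` in `D` for a member `g k` of `f k` would give a transversal inside
  -- `B` that is no larger than `D`.
  obtain ⟨i, hi⟩ := hf (D.image (Sum.elim g id)) (Finset.card_image_le.trans hle)
  obtain ⟨u, hu, hui⟩ := hD (.inl i)
  refine Finset.disjoint_left.1 hi (Finset.mem_image_of_mem _ hu) ?_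
  rcases u with k | j
  · rcases hui with h | h
    · obtain rfl := Sum.inl_injective h
      exact hg _
    · exact (h : False).elim
  · rcases hui with h | h
    · exact (Sum.inr_ne_inl h).elim
    · exact h

end SplitGraph

/-! ### Asymptotics of the domination ratio. -/

lemma add_one_le_of_mem_ratioSet_punit {d m a b : ℕ} (hd : 1 ≤ d) (hb : m + d < b)
    (h : m * Real.log b < a * Real.exp (-(d * m / ((b : ℝ) - m - d)))) {α : ℝ}
    (hα : α ∈ ratioSet d (⊥ : SimpleGraph PUnit.{u + 1})) :
    (m : ℝ) + 1 ≤ α * (a + b) := by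
  classical
  have hA : Fintype.card (ULift.{u} (Fin a)) = a := by simp
  have hB : Fintype.card (ULift.{u} (Fin b)) = b := by simp
  obtain ⟨f, hf, hf'⟩ := exists_family (ULift.{u} (Fin a)) (ULift.{u} (Fin b))
    (d := d) (m := m) (by rwa [hB]) (by rwa [hA, hB])
  have : Nonempty (ULift.{u} (Fin b)) := Fintype.card_pos_iff.1 (by omega)
  have h1 := hα _ (splitGraph f) (le_minDegree_splitGraph hf (by omega))
  have h2 : m + 1 ≤ isolationNumber (splitGraph f) (⊥ : SimpleGraph PUnit.{u + 1}) :=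
    lt_isolationNumber_splitGraph (fun i => Finset.card_pos.1 (by rw [hf i]; omega)) hf'
  rw [Fintype.card_sum, hA, hB] at h1
  push_cast at h1
  refine le_trans ?_ h1
  exact_mod_cast h2

/-- The numerator of `alpha d` is at most `ln d + 2`, and `η ln d` absorbs the 2. -/
lemma alpha_le_mul_log_div {η : ℝ} {d : ℕ} (hd : 1 ≤ d) (h : 2 ≤ η * Real.log d) :
    alpha d ≤ (1 + η) * (Real.log d / d) := by
  have hd1 : (1 : ℝ) ≤ d := by exact_mod_cast hd
  have hdpos : (0 : ℝ) < d := by linarith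
  have hlog : Real.log ((d : ℝ) + 1) ≤ Real.log d + 1 := by
    have h2 : (d : ℝ) + 1 ≤ d * Real.exp 1 := by
      nlinarith [Real.add_one_le_exp (1 : ℝ)]
    have h3 := Real.log_le_log (by positivity) h2
    rwa [Real.log_mul hdpos.ne' (Real.exp_pos 1).ne', Real.log_exp] at h3
  have hlog0 := Real.log_nonneg hd1
  rw [alpha, ← mul_div_assoc]
  exact div_le_div₀ (by linarith) (by linarith) hdpos (by linarith)

/-- Collects the losses: `1 + 2η` from the order of the graph, `1 + η` from comparing `alpha d` with
`ln d / d`, `1 - η` from the choice of `m`. The two sides differ by `10η² + 8η³`. -/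
lemma one_add_two_mul_mul_le {η : ℝ} (hη : 0 ≤ η) :
    (1 + 2 * η) * ((1 - 4 * η) * (1 + η)) ≤ 1 - η := by
  have h2 : 0 ≤ η ^ 2 := by positivity
  have h3 : 0 ≤ η ^ 3 := by positivity
  linarith

-- Take `|B| = d²`, `|A| = ⌈ηd²⌉` and `m = ⌊(1-η) d ln d⌋`. An `m`-set misses a random `d`-set with
-- probability at least `d^(-(1-η/2))`, so the expected number of missed sets is at least `η
-- d^(1+η/2)`. This exceeds `m ln |B| ≤ 2d (ln d)²` for large `d`, while the order stays below
-- `(1+2η)d²`.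
open Filter Topology in
lemma eventually_mul_alpha_le_extremalRatio {η : ℝ} (hη : 0 < η) (hη1 : η < 1 / 4) :
    ∀ᶠ d : ℕ in atTop, (1 - 4 * η) * alpha d ≤
      extremalRatio d (⊥ : SimpleGraph PUnit.{u + 1}) := by
  have hL0 : Tendsto (fun d : ℕ => Real.log d) atTop atTop :=
    Real.tendsto_log_atTop.comp tendsto_natCast_atTop_atTop
  have hLd : ∀ᶠ d : ℕ in atTop, Real.log d ≤ η / 4 * d := by
    have := (Real.isLittleO_log_id_atTop.comp_tendsto
      (tendsto_natCast_atTop_atTop (R := ℝ))).bound (show (0 : ℝ) < η / 4 by positivity)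
    filter_upwards [this] with d hd
    have h2 : ‖((d : ℕ) : ℝ)‖ = d := by simp
    simp only [Function.comp_apply, id] at hd
    rw [h2] at hd
    exact (le_abs_self _).trans hd
  have hpow : ∀ᶠ d : ℕ in atTop, 2 * Real.log d ^ 2 < η * Real.exp (η / 2 * Real.log d) := by
    have h1 := ((isLittleO_pow_exp_pos_mul_atTop (k := 2)
      (show (0 : ℝ) < η / 2 by positivity)).comp_tendsto hL0).bound
      (show (0 : ℝ) < η / 4 by positivity)
    filter_upwards [h1] with d hd
    simp only [Function.comp_apply, norm_pow, Real.norm_eq_abs, sq_abs, Real.abs_exp] at hd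
    have := Real.exp_pos (η / 2 * Real.log d)
    nlinarith
  filter_upwards [hL0.eventually_ge_atTop (3 / η), hLd, hpow, eventually_ge_atTop 1,
    tendsto_natCast_atTop_atTop.eventually_ge_atTop (4 / η)] with d hL3 hLd hpow hd1 hd4
  have hdpos : (0 : ℝ) < d := by exact_mod_cast hd1
  set L := Real.log d with hL
  have hηL : 3 ≤ η * L := by
    rw [div_le_iff₀ hη] at hL3
    linarith
  have hηd : 4 ≤ η * d := by
    rw [div_le_iff₀ hη] at hd4
    linarith
  have hLpos : 0 < L := by
    by_contra! h
    nlinarith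
  set m := ⌊(1 - η) * d * L⌋₊ with hm
  set a := ⌈η * d ^ 2⌉₊ with ha
  have hnn : 0 ≤ (1 - η) * d * L := by
    have : 0 < 1 - η := by linarith
    positivity
  have hm1 : (m : ℝ) ≤ (1 - η) * d * L := Nat.floor_le hnn
  have hm2 : (1 - η) * d * L < m + 1 := Nat.lt_floor_add_one _
  have ha1 : η * d ^ 2 ≤ (a : ℝ) := Nat.le_ceil _
  have ha2 : (a : ℝ) < η * d ^ 2 + 1 := Nat.ceil_lt_add_one (by positivity)
  have hdL : (d : ℝ) * L ≤ η / 4 * d ^ 2 := by nlinarith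
  have hd2 : (d : ℝ) ≤ η / 4 * d ^ 2 := by nlinarith
  have hmdL : (m : ℝ) ≤ d * L := hm1.trans (by nlinarith [mul_pos hdpos hLpos])
  have hden : (1 - η / 2) * (d : ℝ) ^ 2 ≤ ((d ^ 2 : ℕ) : ℝ) - m - d := by
    push_cast
    nlinarith
  have hden0 : 0 < (1 - η / 2) * (d : ℝ) ^ 2 := by
    have : 0 < 1 - η / 2 := by linarith
    positivity
  have hb : m + d < d ^ 2 := by
    have : (m : ℝ) + d < (d ^ 2 : ℕ) := by linarith
    exact_mod_cast this
  -- Rests on `1 - η ≤ (1 - η/2)²`; one factor `1 - η/2` pays for the denominator.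
  have hexp : d * m / (((d ^ 2 : ℕ) : ℝ) - m - d) ≤ (1 - η / 2) * L := by
    rw [div_le_iff₀ (hden0.trans_le hden)]
    have h1 : (d : ℝ) * m ≤ d * ((1 - η) * d * L) := mul_le_mul_of_nonneg_left hm1 hdpos.le
    have h2 : (1 - η / 2) * L * ((1 - η / 2) * (d : ℝ) ^ 2) ≤
        (1 - η / 2) * L * (((d ^ 2 : ℕ) : ℝ) - m - d) :=
      mul_le_mul_of_nonneg_left hden (by nlinarith)
    have h3 : 0 ≤ η ^ 2 * (d ^ 2 * L) := by positivity
    nlinarith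
  have hcount : m * Real.log (d ^ 2 : ℕ) <
      a * Real.exp (-(d * m / (((d ^ 2 : ℕ) : ℝ) - m - d))) := by
    have h1 : Real.exp (-((1 - η / 2) * L)) ≤
        Real.exp (-(d * m / (((d ^ 2 : ℕ) : ℝ) - m - d))) :=
      Real.exp_le_exp.2 (neg_le_neg hexp)
    have h2 : Real.exp (-((1 - η / 2) * L)) * d = Real.exp (η / 2 * L) := by
      rw [← Real.exp_log hdpos, ← hL, ← Real.exp_add]
      congr 1
      ring
    calc m * Real.log (d ^ 2 : ℕ) = m * (2 * L) := by
          rw [Nat.cast_pow, Real.log_pow, ← hL, Nat.cast_two]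
      _ ≤ d * L * (2 * L) := mul_le_mul_of_nonneg_right hmdL (by positivity)
      _ = d * (2 * L ^ 2) := by ring
      _ < d * (η * Real.exp (η / 2 * L)) := mul_lt_mul_of_pos_left hpow hdpos
      _ = η * d ^ 2 * Real.exp (-((1 - η / 2) * L)) := by
          rw [← h2]
          ring
      _ ≤ _ := mul_le_mul ha1 h1 (Real.exp_pos _).le (by positivity)
  refine le_csInf (ratioSet_nonempty d _) fun α hα => ?_
  have hmain := add_one_le_of_mem_ratioSet_punit hd1 hb hcount hα
  push_cast at hmain
  have hα0 : 0 ≤ α := by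
    by_contra! h
    have : α * (a + d ^ 2) ≤ 0 := mul_nonpos_of_nonpos_of_nonneg h.le (by positivity)
    have : (0 : ℝ) ≤ m := Nat.cast_nonneg _
    linarith
  have hn : (a : ℝ) + d ^ 2 ≤ (1 + 2 * η) * d ^ 2 := by nlinarith
  have h1 : (1 - η) * L ≤ α * ((1 + 2 * η) * d) := by
    have h2 : (1 - η) * d * L ≤ α * ((1 + 2 * η) * d ^ 2) :=
      -- The `+ 1` gained from strictness in the isolation number cancels the rounding of `m`.
      hm2.le.trans (hmain.trans (mul_le_mul_of_nonneg_left hn hα0))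
    refine le_of_mul_le_mul_left ?_ hdpos
    linarith
  have hαd : alpha d ≤ (1 + η) * (L / d) := alpha_le_mul_log_div hd1 (by linarith)
  have h3 : (1 - η) * (L / d) ≤ (1 + 2 * η) * α := by
    rw [← mul_div_assoc, div_le_iff₀ hdpos]
    linarith
  have h4 : (1 - 4 * η) * alpha d ≤ (1 - 4 * η) * ((1 + η) * (L / d)) :=
    mul_le_mul_of_nonneg_left hαd (by linarith)
  have hLd0 : 0 < L / d := by positivity
  have h5 : (1 + 2 * η) * ((1 - 4 * η) * ((1 + η) * (L / d))) ≤ (1 - η) * (L / d) := by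
    have : (1 + 2 * η) * ((1 - 4 * η) * (1 + η)) ≤ 1 - η := one_add_two_mul_mul_le hη.le
    calc _ = (1 + 2 * η) * ((1 - 4 * η) * (1 + η)) * (L / d) := by ring
      _ ≤ _ := mul_le_mul_of_nonneg_right this hLd0.le
  exact h4.trans (le_of_mul_le_mul_left (h5.trans h3) (by linarith))

open Filter Topology in
lemma tendsto_extremalRatio_punit_div_alpha :
    Tendsto (fun d => extremalRatio d (⊥ : SimpleGraph PUnit.{u + 1}) / alpha d) atTop (𝓝 1) := by
  rw [tendsto_order]
  constructor
  · intro c hc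
    obtain ⟨η, hη, hηlt⟩ := exists_between (lt_min (show 0 < (1 - c) / 4 by linarith)
      (show (0 : ℝ) < 1 / 4 by norm_num))
    have h1 := hηlt.trans_le (min_le_left _ _)
    filter_upwards [eventually_mul_alpha_le_extremalRatio.{u} hη
      (hηlt.trans_le (min_le_right _ _))] with d hd
    rw [lt_div_iff₀ (alpha_pos d)]
    exact (mul_lt_mul_of_pos_right (by linarith) (alpha_pos d)).trans_le hd
  · intro c hc
    refine Eventually.of_forall fun d => lt_of_le_of_lt ?_ hc
    rw [div_le_one (alpha_pos d)]
    exact extremalRatio_le_alpha d _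

end Isolation

/-- The `o(1)` term is a function `ε` of `d` alone, the same for all graphs `F`. -/
theorem theorem3p6 :
    ∃ ε : ℕ → ℝ, Filter.Tendsto ε Filter.atTop (nhds 0) ∧
      ∀ d : ℕ, 1 ≤ d → ∀ (V : Type u) [Fintype V] [Nonempty V] (F : SimpleGraph V),
        (1 + ε d) / (Fintype.card V : ℝ) * Isolation.alpha d ≤ Isolation.extremalRatio d F ∧
          Isolation.extremalRatio d F ≤ Isolation.alpha d := by
  -- With this `ε`, `(1 + ε d) α_d` is exactly the ratio for `K₁`, so the lower bound is the blow-up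
  -- inequality for every `d`.
  refine ⟨fun d => Isolation.extremalRatio d (⊥ : SimpleGraph PUnit.{u + 1}) /
    Isolation.alpha d - 1, ?_, fun d _ V _ _ F => ⟨?_, Isolation.extremalRatio_le_alpha d F⟩⟩
  · simpa using Isolation.tendsto_extremalRatio_punit_div_alpha.{u}.sub_const 1
  · refine le_of_eq_of_le ?_ (Isolation.extremalRatio_punit_le d F)
    have := (Isolation.alpha_pos d).ne'
    rw [add_sub_cancel]
    field_simp
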